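/- Let $G$ be a compact, connected, semisimple Lie group, let $T$ be a Cartan subgroup (maximal torus) of $G$, and let $K$ be a closed subgroup of $G$ with $T\subseteq K\subseteq G$. Let $G$ act on $G/T$ and on $M=G/K$ by left multiplication; for a subgroup $H$ of $G$ and a $G$-set $X$ write $X^H$ for the set of points of $X$ fixed by $H$. Let $W_G=N_G(T)/T$ and $W_K=N_K(T)/T$ be the Weyl groups of $G$ and $K$. Then for every subtorus $H$ of $T$ the projection $G/T\to G/K$, $gT\mapsto gK$, maps $(G/T)^H$ onto $(G/K)^H$. Moreover, the inclusion $N_K(T)\subseteq N_G(T)$ induces an injective homomorphism $W_K\to W_G$, and, $W_K$ being regarded as a subgroup of $W_G$ in this way, $[n]\mapsto nK$ (for $n\in N_G(T)$) is a well-defined bijection $W_G/W_K\to M^T$; in particular $W_G$ acts transitively on $M^T$ by $[n]\cdot p=n\cdot p$. -/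

import Mathlib

open scoped Manifold ContDiff

/-- A smooth real Lie group is semisimple if its Lie algebra is semisimple. -/
def IsSemisimpleLieGroup (E : Type*) [NormedAddCommGroup E] [NormedSpace ℝ E]
    [FiniteDimensional ℝ E] (G : Type*) [Group G] [TopologicalSpace G] [ChartedSpace E G]
    [LieGroup 𝓘(ℝ, E) ∞ G] : Prop :=
  haveI : CompleteSpace E := FiniteDimensional.complete ℝ E
  haveI : LieGroup 𝓘(ℝ, E) (minSmoothness ℝ 3) G :=
    LieGroup.of_le (n := ∞) (by
      rw [minSmoothness_of_isRCLikeNormedField]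
      exact ENat.LEInfty.out)
  LieAlgebra.IsSemisimple ℝ (GroupLieAlgebra 𝓘(ℝ, E) G)

/-- A subgroup is a torus if, with the subspace topology, it is isomorphic as a topological group
to a finite power of the circle group. (Such a subgroup of a Hausdorff group is automatically
compact, hence closed.) -/
def IsTorus {G : Type*} [Group G] [TopologicalSpace G] (H : Subgroup G) : Prop :=
  ∃ n : ℕ, Nonempty (H ≃ₜ* (Fin n → Circle))

/-- A maximal torus: a torus contained in no larger torus. In a compact connected Lie group
these are the Cartan subgroups. -/
def IsMaximalTorus {G : Type*} [Group G] [TopologicalSpace G] (T : Subgroup G) : Prop :=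
  IsTorus T ∧ ∀ T' : Subgroup G, IsTorus T' → T ≤ T' → T' = T

/-- The Weyl group `N(T)/T`. -/
abbrev WeylGroup {G : Type*} [Group G] (T : Subgroup G) : Type _ :=
  Subgroup.normalizer (T : Set G) ⧸ T.subgroupOf (Subgroup.normalizer (T : Set G))

/-- For `T ≤ K`, the inclusion `N_K(T) → N_G(T)`. -/
def normalizerIncl {G : Type*} [Group G] {T K : Subgroup G} (h : T ≤ K) :
    Subgroup.normalizer ((T.subgroupOf K : Subgroup K) : Set K) →*
      Subgroup.normalizer (T : Set G) :=
  (K.subtype.comp (Subgroup.subtype _)).codRestrict _ (by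
    intro n
    rw [← SetLike.mem_coe]
    intro t
    have hn := n.2
    constructor
    · intro ht
      exact (hn ⟨t, h ht⟩).1 ht
    · intro ht
      have htK : t ∈ K := by
        have h1 := K.mul_mem (K.mul_mem (K.inv_mem n.1.2) (h ht)) n.1.2
        simpa [mul_assoc] using h1
      exact (hn ⟨t, htK⟩).2 ht)

/-- For `T ≤ K`, the homomorphism `W_K = N_K(T)/T → W_G = N_G(T)/T` induced by the inclusion. -/
def weylIncl {G : Type*} [Group G] {T K : Subgroup G} (h : T ≤ K) :
    WeylGroup (T.subgroupOf K) →* WeylGroup T :=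
  QuotientGroup.map _ _ (normalizerIncl h) (fun _ hn => hn)

/-- The set `X^H` of points of a `G`-set `X` fixed by a subgroup `H` of `G`. -/
abbrev fixedPts {G : Type*} [Group G] (H : Subgroup G) (X : Type*) [MulAction G X] : Set X :=
  MulAction.fixedPoints H X

/-- The normalizer of `T` permutes the `T`-fixed points of a `G`-set. -/
def normalizerPerm {G : Type*} [Group G] (T : Subgroup G) (X : Type*) [MulAction G X] :
    Subgroup.normalizer (T : Set G) →* Equiv.Perm (fixedPts T X) :=
  haveI key : ∀ (n : Subgroup.normalizer (T : Set G)) (x : X),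
      x ∈ fixedPts T X → (n : G) • x ∈ fixedPts T X := by
    intro n x hx t
    have h1 : (n : G)⁻¹ * t * (n : G)⁻¹⁻¹ ∈ T :=
      ((Subgroup.normalizer (T : Set G)).inv_mem n.2 (t : G)).1 t.2
    have h2 : ((n : G)⁻¹ * t * (n : G)⁻¹⁻¹) • x = x := hx ⟨_, h1⟩
    have h3 : (n : G) • ((n : G)⁻¹ * t * (n : G)⁻¹⁻¹) • x = (n : G) • x := by rw [h2]
    rw [smul_smul] at h3
    change (t : G) • (n : G) • x = (n : G) • x
    rw [smul_smul, ← h3]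
    congr 1
    group
  { toFun := fun n =>
      { toFun := fun x => ⟨(n : G) • (x : X), key n x x.2⟩
        invFun := fun x => ⟨((n⁻¹ : Subgroup.normalizer (T : Set G)) : G) • (x : X),
          key n⁻¹ x x.2⟩
        left_inv := fun x => Subtype.ext (by simp)
        right_inv := fun x => Subtype.ext (by simp) }
    map_one' := Equiv.ext fun x => Subtype.ext (by simp)
    map_mul' := fun a b => Equiv.ext fun x => Subtype.ext (by simp [mul_smul]) }

/-- The action of the Weyl group `N(T)/T` on the `T`-fixed points of a `G`-set,
`[n] • x = n • x`. -/
instance weylAction {G : Type*} [Group G] (T : Subgroup G) (X : Type*) [MulAction G X] :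
    MulAction (WeylGroup T) (fixedPts T X) :=
  MulAction.compHom _ (QuotientGroup.lift _ (normalizerPerm T X) (by
    intro n hn
    exact Equiv.ext fun x => Subtype.ext (x.2 ⟨n, hn⟩)))

open Filter Topology MeasureTheory

/-! A coset `gK` is fixed by `H` exactly when `g⁻¹Hg ≤ K`, so everything rests on one conjugacy
statement (`exists_conj_le_maximalTorus`): a torus lying in `K` is conjugate into `T` by an element
of `K`. It yields `k ∈ K` with `(gk)⁻¹H(gk) ≤ T`, so that `gkT` is an `H`-fixed point over `gK`. For
`H = T`, maximality puts `gk` in `N(T)`; hence `W_G` is transitive on the `T`-fixed points. The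
stabilizer of the base point consists of the classes of `n ∈ N(T) ∩ K`, that is, of `W_K`, and
orbit-stabilizer gives the bijection.

Conjugacy is proved by Hunt's variational argument, carried out inside the compact group `K`, which
need not be connected. Let `X`, `Y` generate two one-parameter subgroups of `K` in an orthogonal
representation `ρ` of `G`. A point `k` of `K` maximizing `tr (X ρ(k) Y ρ(k)⁻¹)` makes `X` commute
with `ρ(k) Y ρ(k)⁻¹`. The kernel of `ρ` is central, so commutators in `G` are central, and they are
trivial because one of the subgroups is periodic. Treating finitely many circles in turn makes a
circle of `K` commute with `T`, and maximality then places it in `T`.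

The representation is the adjoint one, made orthogonal by averaging. Its kernel is central because
averaging a chart over conjugation gives a map, injective near `1`, that intertwines conjugation
with `Ad`. -/

theorem chart_symm_one {E G : Type*} [TopologicalSpace E] [TopologicalSpace G] [One G]
    [ChartedSpace E G] : (chartAt E (1 : G)).symm (chartAt E (1 : G) 1) = 1 :=
  (chartAt E (1 : G)).left_inv (mem_chart_source E 1)

/-! ### The adjoint representation in a chart at the identity. -/

section ChartConjugation

variable {E : Type*} [NormedAddCommGroup E] [NormedSpace ℝ E]
  {G : Type*} [Group G] [TopologicalSpace G] [ChartedSpace E G]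

/-- Conjugation by `g`, read in the preferred chart at the identity. -/
noncomputable def conjChart (E : Type*) [NormedAddCommGroup E] [NormedSpace ℝ E]
    {G : Type*} [Group G] [TopologicalSpace G] [ChartedSpace E G] (g : G) (u : E) : E :=
  chartAt E (1 : G) (g * (chartAt E (1 : G)).symm u * g⁻¹)

/-- The adjoint representation, read in the preferred chart at the identity. -/
noncomputable def chartAd (E : Type*) [NormedAddCommGroup E] [NormedSpace ℝ E]
    {G : Type*} [Group G] [TopologicalSpace G] [ChartedSpace E G] (g : G) : E →L[ℝ] E :=
  fderiv ℝ (conjChart E g) (chartAt E (1 : G) 1)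

theorem conjChart_one (g : G) :
    conjChart E g (chartAt E (1 : G) 1) = chartAt E (1 : G) 1 := by
  simp [conjChart]

variable [LieGroup 𝓘(ℝ, E) ∞ G]

theorem contDiffAt_conj_in_charts (g : G) :
    ContDiffAt ℝ ∞ (fun p : E × E => conjChart E ((chartAt E g).symm p.1) p.2)
      (chartAt E g g, chartAt E (1 : G) 1) := by
  have hg : ContMDiffAt 𝓘(ℝ, E × E) 𝓘(ℝ, E) ∞
      (fun p : E × E => (chartAt E g).symm p.1) (chartAt E g g, chartAt E (1 : G) 1) :=
    ((contMDiffOn_chart_symm (I := 𝓘(ℝ, E)) (n := ∞) (x := g)).contMDiffAt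
      ((chartAt E g).open_target.mem_nhds (mem_chart_target E g))).comp
      (chartAt E g g, chartAt E (1 : G) 1) contDiff_fst.contMDiff.contMDiffAt
  have h1 : ContMDiffAt 𝓘(ℝ, E × E) 𝓘(ℝ, E) ∞
      (fun p : E × E => (chartAt E (1 : G)).symm p.2) (chartAt E g g, chartAt E (1 : G) 1) :=
    ((contMDiffOn_chart_symm (I := 𝓘(ℝ, E)) (n := ∞) (x := (1 : G))).contMDiffAt
      ((chartAt E (1 : G)).open_target.mem_nhds (mem_chart_target E (1 : G)))).comp
      (chartAt E g g, chartAt E (1 : G) 1) contDiff_snd.contMDiff.contMDiffAt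
  have h := (contMDiffOn_chart (I := 𝓘(ℝ, E)) (n := ∞) (x := (1 : G))).contMDiffAt
      ((chartAt E (1 : G)).open_source.mem_nhds (mem_chart_source E (1 : G)))
  refine ContMDiffAt.contDiffAt ?_
  refine ContMDiffAt.comp (g := chartAt E (1 : G)) _ ?_ ((hg.mul h1).mul hg.inv)
  convert h
  simp

theorem hasFDerivAt_conjChart (g : G) :
    HasFDerivAt (conjChart E g) (chartAd E g) (chartAt E (1 : G) 1) := by
  have h := (contDiffAt_conj_in_charts (E := E) g).differentiableAt (by simp)
  have h2 := h.hasFDerivAt.comp (chartAt E (1 : G) 1)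
    (hasFDerivAt_prodMk_right (chartAt E g g) (chartAt E (1 : G) 1))
  have h3 : (fun p : E × E => conjChart E ((chartAt E g).symm p.1) p.2) ∘ Prod.mk (chartAt E g g)
      = conjChart E g := by
    ext u
    simp
  rw [h3] at h2
  exact h2.differentiableAt.hasFDerivAt

/-- Conjugation is jointly smooth, hence jointly strictly differentiable. Comparing two points with
the same group coordinate leaves only the partial derivative in the chart variable, with an error
uniform for group elements near `g`. -/
theorem eventually_norm_conjChart_sub_le (g : G) {ε : ℝ} (hε : 0 < ε) :
    ∀ᶠ q : G × (E × E) in 𝓝 (g, (chartAt E (1 : G) 1, chartAt E (1 : G) 1)),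
      ‖conjChart E q.1 q.2.1 - conjChart E q.1 q.2.2 - chartAd E g (q.2.1 - q.2.2)‖
        ≤ ε * ‖q.2.1 - q.2.2‖ := by
  have h := (contDiffAt_conj_in_charts (E := E) g).hasStrictFDerivAt (by simp)
  set D := fderiv ℝ (fun p : E × E => conjChart E ((chartAt E g).symm p.1) p.2)
    (chartAt E g g, chartAt E (1 : G) 1) with hD
  have hDe : ∀ w, D (0, w) = chartAd E g w := by
    intro w
    have h2 := h.hasFDerivAt.comp (chartAt E (1 : G) 1)
      (hasFDerivAt_prodMk_right (chartAt E g g) (chartAt E (1 : G) 1))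
    have h3 : (fun p : E × E => conjChart E ((chartAt E g).symm p.1) p.2) ∘
        Prod.mk (chartAt E g g) = conjChart E g := by
      ext u
      simp
    rw [h3] at h2
    rw [h2.unique (hasFDerivAt_conjChart g) |>.symm]
    simp
  have hb := h.isLittleO.def hε
  have ht : Tendsto (fun q : G × (E × E) =>
      ((chartAt E g q.1, q.2.1), (chartAt E g q.1, q.2.2)))
      (𝓝 (g, (chartAt E (1 : G) 1, chartAt E (1 : G) 1)))
      (𝓝 ((chartAt E g g, chartAt E (1 : G) 1), (chartAt E g g, chartAt E (1 : G) 1))) := by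
    have hc : ContinuousAt (fun q : G × (E × E) => chartAt E g q.1)
        (g, (chartAt E (1 : G) 1, chartAt E (1 : G) 1)) :=
      ContinuousAt.comp (g := chartAt E g) ((chartAt E g).continuousAt (mem_chart_source E g))
        continuousAt_fst
    exact (hc.prodMk (by fun_prop)).prodMk (hc.prodMk (by fun_prop))
  have hs : ∀ᶠ q : G × (E × E) in 𝓝 (g, (chartAt E (1 : G) 1, chartAt E (1 : G) 1)),
      q.1 ∈ (chartAt E g).source :=
    continuousAt_fst.eventually ((chartAt E g).open_source.mem_nhds (mem_chart_source E g))
  filter_upwards [ht.eventually hb, hs] with q hq hqs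
  simp only [Prod.mk_sub_mk, sub_self, (chartAt E g).left_inv hqs, hDe, Prod.norm_mk, norm_zero]
    at hq
  rwa [max_eq_right (norm_nonneg _)] at hq

theorem continuous_chartAd : Continuous (chartAd E : G → E →L[ℝ] E) := by
  rw [continuous_iff_continuousAt]
  intro g
  rw [Metric.continuousAt_iff']
  intro ε hε
  have h := eventually_norm_conjChart_sub_le (E := E) g (half_pos hε)
  rw [nhds_prod_eq] at h
  filter_upwards [h.curry] with k hk
  -- Near the base point, `conjChart E k - chartAd E g` satisfies a Lipschitz bound with constant `ε
  -- / 2`, so its derivative has norm at most `ε / 2`.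
  have hk' : ∀ᶠ u in 𝓝 (chartAt E (1 : G) 1), ‖conjChart E k u - chartAd E g u
      - (conjChart E k (chartAt E (1 : G) 1) - chartAd E g (chartAt E (1 : G) 1))‖
      ≤ ε / 2 * ‖u - chartAt E (1 : G) 1‖ := by
    have ht : Tendsto (fun u : E => (u, chartAt E (1 : G) 1)) (𝓝 (chartAt E (1 : G) 1))
        (𝓝 (chartAt E (1 : G) 1, chartAt E (1 : G) 1)) := by
      apply Continuous.tendsto
      fun_prop
    filter_upwards [ht.eventually hk] with u hu
    convert hu using 2
    rw [map_sub]
    abel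
  have hd : HasFDerivAt (fun u => conjChart E k u - chartAd E g u)
      (chartAd E k - chartAd E g) (chartAt E (1 : G) 1) :=
    (hasFDerivAt_conjChart k).sub (chartAd E g).hasFDerivAt
  rw [dist_eq_norm]
  exact (hd.le_of_lip' (half_pos hε).le hk').trans_lt (half_lt_self hε)

theorem chartAd_one : chartAd E (1 : G) = ContinuousLinearMap.id ℝ E := by
  refine HasFDerivAt.unique (hasFDerivAt_conjChart (E := E) (1 : G)) ?_
  refine (hasFDerivAt_id _).congr_of_eventuallyEq ?_
  filter_upwards [(chartAt E (1 : G)).open_target.mem_nhds (mem_chart_target E (1 : G))] with u hu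
  simp [conjChart, (chartAt E (1 : G)).right_inv hu]

theorem chartAd_mul (g h : G) : chartAd E (g * h) = (chartAd E g).comp (chartAd E h) := by
  refine HasFDerivAt.unique (hasFDerivAt_conjChart (g * h)) ?_
  have h1 : HasFDerivAt (conjChart E g) (chartAd E g) (conjChart E h (chartAt E (1 : G) 1)) := by
    rw [conjChart_one]
    exact hasFDerivAt_conjChart g
  refine (h1.comp _ (hasFDerivAt_conjChart h)).congr_of_eventuallyEq ?_
  have : IsTopologicalGroup G := topologicalGroup_of_lieGroup 𝓘(ℝ, E) ∞
  have hc : ContinuousAt (fun u : E => h * (chartAt E (1 : G)).symm u * h⁻¹)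
      (chartAt E (1 : G) 1) :=
    (continuousAt_const.mul ((chartAt E (1 : G)).symm.continuousAt
      (mem_chart_target E (1 : G)))).mul continuousAt_const
  have hm := hc.eventually (p := fun x => x ∈ (chartAt E (1 : G)).source) (by
    simpa [chart_symm_one] using (chartAt E (1 : G)).open_source.mem_nhds (mem_chart_source E (1 : G)))
  filter_upwards [hm] with u hu
  simp only [conjChart, Function.comp_apply, (chartAt E (1 : G)).left_inv hu]
  congr 1
  group

theorem eventually_norm_conjChart_sub_le' (g : G) {ε : ℝ} (hε : 0 < ε) :
    ∀ᶠ z : (E × E) × G in 𝓝 ((chartAt E (1 : G) 1, chartAt E (1 : G) 1), g),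
      ‖conjChart E z.2 z.1.1 - conjChart E z.2 z.1.2 - chartAd E z.2 (z.1.1 - z.1.2)‖
        ≤ ε * ‖z.1.1 - z.1.2‖ := by
  have h1 := eventually_norm_conjChart_sub_le (E := E) g (half_pos hε)
  have h2 : ∀ᶠ k in 𝓝 g, dist (chartAd E k) (chartAd E g) < ε / 2 :=
    Metric.tendsto_nhds.1 (continuous_chartAd.tendsto g) _ (half_pos hε)
  have hsw := (continuous_swap (X := E × E) (Y := G)).tendsto
    ((chartAt E (1 : G) 1, chartAt E (1 : G) 1), g)
  have hsnd : Tendsto (Prod.snd : (E × E) × G → G)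
      (𝓝 ((chartAt E (1 : G) 1, chartAt E (1 : G) 1), g)) (𝓝 g) := continuousAt_snd
  filter_upwards [hsw.eventually h1, hsnd.eventually h2] with p hp1 hp2
  rw [dist_eq_norm] at hp2
  have hp3 := (chartAd E p.2 - chartAd E g).le_of_opNorm_le hp2.le (p.1.1 - p.1.2)
  have hp4 : conjChart E p.2 p.1.1 - conjChart E p.2 p.1.2 - chartAd E p.2 (p.1.1 - p.1.2)
      = (conjChart E p.2 p.1.1 - conjChart E p.2 p.1.2 - chartAd E g (p.1.1 - p.1.2))
        - (chartAd E p.2 - chartAd E g) (p.1.1 - p.1.2) := by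
    rw [sub_apply]
    abel
  rw [hp4]
  refine (norm_sub_le _ _).trans ((add_le_add hp1 hp3).trans_eq ?_)
  rw [Prod.snd_swap]
  ring

/-- The local estimates in `g` are uniform by compactness of `G`; this uniformity allows integration
over `G`. -/
theorem eventually_forall_norm_conjChart_sub_le [CompactSpace G] {ε : ℝ} (hε : 0 < ε) :
    ∀ᶠ p : E × E in 𝓝 (chartAt E (1 : G) 1, chartAt E (1 : G) 1), ∀ g : G,
      ‖conjChart E g p.1 - conjChart E g p.2 - chartAd E g (p.1 - p.2)‖ ≤ ε * ‖p.1 - p.2‖ := by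
  have key := isCompact_univ.eventually_forall_of_forall_eventually
    (P := fun (p : E × E) (g : G) =>
      ‖conjChart E g p.1 - conjChart E g p.2 - chartAd E g (p.1 - p.2)‖ ≤ ε * ‖p.1 - p.2‖)
    fun g _ => eventually_norm_conjChart_sub_le' g hε
  exact key.mono fun p hp g => hp g trivial

end ChartConjugation

/-! ### The averaged chart, and centrality of the kernel of `Ad`. -/

section ChartAverage

variable {E : Type*} [NormedAddCommGroup E] [NormedSpace ℝ E]
  {G : Type*} [Group G] [TopologicalSpace G] [ChartedSpace E G] [LieGroup 𝓘(ℝ, E) ∞ G]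
  [MeasurableSpace G]

/-- The average over the group of the conjugates of the chart at the identity. It is equivariant
for conjugation and the adjoint representation. -/
noncomputable def chartAverage (E : Type*) [NormedAddCommGroup E] [NormedSpace ℝ E]
    {G : Type*} [Group G] [TopologicalSpace G] [ChartedSpace E G] [MeasurableSpace G]
    (μ : Measure G) (x : G) : E :=
  ∫ g, chartAd E g (chartAt E (1 : G) (g⁻¹ * x * g)) ∂μ

/-- Left invariance of the measure turns conjugation by `a` into `Ad a` applied to the average, and
`Ad a` is the identity here. -/
theorem chartAverage_conj [MeasurableMul G] (μ : Measure G) [μ.IsMulLeftInvariant] {a : G}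
    (ha : chartAd E a = ContinuousLinearMap.id ℝ E) (x : G) :
    chartAverage E μ (a * x * a⁻¹) = chartAverage E μ x := by
  have ha' : chartAd E a⁻¹ = ContinuousLinearMap.id ℝ E := by
    have h := chartAd_mul (E := E) a a⁻¹
    rw [mul_inv_cancel, chartAd_one, ha] at h
    exact h.symm
  unfold chartAverage
  rw [← integral_mul_left_eq_self (μ := μ)
    (fun g => chartAd E g (chartAt E (1 : G) (g⁻¹ * x * g))) a⁻¹]
  congr 1
  ext g
  rw [chartAd_mul, ha', ContinuousLinearMap.id_comp]
  congr 2
  group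

omit [MeasurableSpace G] in
theorem exists_norm_chartAd_le [CompactSpace G] : ∃ C : ℝ, 0 < C ∧ ∀ g : G, ‖chartAd E g‖ ≤ C := by
  obtain ⟨C, hC⟩ := isCompact_univ.exists_bound_of_continuousOn
    (continuous_chartAd (E := E) (G := G)).continuousOn
  exact ⟨max C 1, by positivity, fun g => (hC g trivial).trans (le_max_left _ _)⟩

variable [CompactSpace G] [BorelSpace G]

theorem eventually_integrable_chartAd_conj [FiniteDimensional ℝ E] (μ : Measure G)
    [IsFiniteMeasure μ] :
    ∀ᶠ x in 𝓝 (1 : G),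
      Integrable (fun g => chartAd E g (chartAt E (1 : G) (g⁻¹ * x * g))) μ := by
  have : IsTopologicalGroup G := topologicalGroup_of_lieGroup 𝓘(ℝ, E) ∞
  have key : ∀ᶠ x in 𝓝 (1 : G), ∀ g ∈ (Set.univ : Set G),
      g⁻¹ * x * g ∈ (chartAt E (1 : G)).source := by
    refine isCompact_univ.eventually_forall_of_forall_eventually fun g _ => ?_
    have hc : Continuous fun z : G × G => z.2⁻¹ * z.1 * z.2 := by fun_prop
    refine hc.continuousAt.eventually ((chartAt E (1 : G)).open_source.mem_nhds ?_)
    simp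
  filter_upwards [key] with x hx
  have hc : Continuous fun g : G => chartAt E (1 : G) (g⁻¹ * x * g) :=
    (chartAt E (1 : G)).continuousOn.comp_continuous (by fun_prop) fun g => hx g trivial
  exact (continuous_chartAd.clm_apply hc).integrable_of_hasCompactSupport
    (HasCompactSupport.of_compactSpace _)

/-- To first order, each integrand changes by `Ad g (Ad g⁻¹ w) = w`, where `w` is the difference of
the chart values. With a uniform bound `C` on `Ad` and relative error `(2C)⁻¹`, equal averages force
`‖w‖ ≤ ‖w‖ / 2`. -/
theorem eventually_injective_chartAverage [FiniteDimensional ℝ E] (μ : Measure G)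
    [IsProbabilityMeasure μ] :
    ∀ᶠ p : G × G in 𝓝 (1, 1), chartAverage E μ p.1 = chartAverage E μ p.2 → p.1 = p.2 := by
  obtain ⟨C, hC0, hC⟩ := exists_norm_chartAd_le (E := E) (G := G)
  have hε : 0 < (2 * C)⁻¹ := by positivity
  set φ := chartAt E (1 : G) with hφ
  have h1 : ContinuousAt φ 1 := φ.continuousAt (mem_chart_source E (1 : G))
  have hφ2 : ContinuousAt (fun p : G × G => (φ p.1, φ p.2)) (1, 1) :=
    (ContinuousAt.comp (x := ((1 : G), (1 : G))) (f := Prod.fst) h1 continuousAt_fst).prodMk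
      (ContinuousAt.comp (x := ((1 : G), (1 : G))) (f := Prod.snd) h1 continuousAt_snd)
  have hint := (eventually_integrable_chartAd_conj (E := E) μ).and
    (φ.open_source.mem_nhds (mem_chart_source E (1 : G)))
  have hint1 : Tendsto Prod.fst (𝓝 ((1 : G), (1 : G))) (𝓝 1) := continuousAt_fst
  have hint2 : Tendsto Prod.snd (𝓝 ((1 : G), (1 : G))) (𝓝 1) := continuousAt_snd
  filter_upwards [hφ2.eventually (eventually_forall_norm_conjChart_sub_le (G := G) hε),
    hint1.eventually hint, hint2.eventually hint] with p hp ⟨hi1, hs1⟩ ⟨hi2, hs2⟩ heq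
  refine φ.injOn hs1 hs2 ?_
  set w := φ p.1 - φ p.2 with hw
  have hid : ∀ g : G, chartAd E g (chartAd E g⁻¹ w) = w := by
    intro g
    rw [← ContinuousLinearMap.comp_apply, ← chartAd_mul, mul_inv_cancel, chartAd_one]
    rfl
  have hsum : ∫ g, chartAd E g (φ (g⁻¹ * p.1 * g) - φ (g⁻¹ * p.2 * g) - chartAd E g⁻¹ w) ∂μ
      = -w := by
    simp only [map_sub, hid]
    have hi3 := integral_sub (hi1.sub hi2) (integrable_const w)
    refine hi3.trans ?_
    rw [integral_sub' hi1 hi2]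
    change chartAverage E μ p.1 - chartAverage E μ p.2 - _ = _
    simp [heq]
  have hle : ‖-w‖ ≤ C * ((2 * C)⁻¹ * ‖w‖) := by
    rw [← hsum]
    refine (norm_integral_le_of_norm_le_const (C := C * ((2 * C)⁻¹ * ‖w‖))
      (Eventually.of_forall fun g => ?_)).trans (by simp)
    refine (chartAd E g).le_of_opNorm_le_of_le (hC g) ?_
    have := hp g⁻¹
    simpa only [conjChart, ← hφ, φ.left_inv hs1, φ.left_inv hs2, inv_inv] using this
  have h2 : C * ((2 * C)⁻¹ * ‖w‖) = ‖w‖ / 2 := by field_simp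
  rw [norm_neg, h2] at hle
  have : ‖w‖ = 0 := by linarith [norm_nonneg w]
  exact sub_eq_zero.1 (norm_eq_zero.1 this)

end ChartAverage

theorem exists_invariant_probability {G : Type*} [Group G] [TopologicalSpace G] [CompactSpace G]
    [IsTopologicalGroup G] [MeasurableSpace G] [BorelSpace G] :
    ∃ μ : Measure G, IsProbabilityMeasure μ ∧ μ.IsMulLeftInvariant ∧ μ.IsOpenPosMeasure :=
  ⟨Measure.haarMeasure ⊤, ⟨by
    have := Measure.haarMeasure_self (K₀ := (⊤ : TopologicalSpace.PositiveCompacts G))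
    simpa using this⟩, inferInstance, inferInstance⟩

/-- The averaged chart does not distinguish `x` from `a * x * a⁻¹`, so its injectivity near `1`
makes the centralizer of `a` a neighbourhood of `1`. It is then an open subgroup of a connected
group. -/
theorem mem_center_of_chartAd_eq_id {E : Type*} [NormedAddCommGroup E] [NormedSpace ℝ E]
    [FiniteDimensional ℝ E] {G : Type*} [Group G] [TopologicalSpace G] [ChartedSpace E G]
    [LieGroup 𝓘(ℝ, E) ∞ G] [CompactSpace G]
    [ConnectedSpace G] {a : G}
    (ha : chartAd E a = ContinuousLinearMap.id ℝ E) : a ∈ Subgroup.center G := by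
  have : IsTopologicalGroup G := topologicalGroup_of_lieGroup 𝓘(ℝ, E) ∞
  borelize G
  obtain ⟨μ, _, _, _⟩ := exists_invariant_probability (G := G)
  have ht : Tendsto (fun x : G => (a * x * a⁻¹, x)) (𝓝 1) (𝓝 (1, 1)) := by
    have hc : Continuous (fun x : G => (a * x * a⁻¹, x)) := by fun_prop
    simpa using hc.tendsto 1
  have hev : ∀ᶠ x in 𝓝 (1 : G), x ∈ Subgroup.centralizer {a} := by
    filter_upwards [ht.eventually (eventually_injective_chartAverage (E := E) μ)] with x hx
    rw [Subgroup.mem_centralizer_singleton_iff]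
    exact (mul_inv_eq_iff_eq_mul.1 (hx (chartAverage_conj μ ha x))).symm
  have htop : Subgroup.centralizer {a} = ⊤ := by
    have hopen : IsOpen (Subgroup.centralizer {a} : Set G) :=
      Subgroup.isOpen_of_mem_nhds _ hev
    exact SetLike.coe_injective
      (IsClopen.eq_univ ⟨Subgroup.isClosed_of_isOpen _ hopen, hopen⟩ ⟨1, one_mem _⟩)
  rw [Subgroup.mem_center_iff]
  intro g
  have : g ∈ Subgroup.centralizer {a} := htop ▸ Subgroup.mem_top g
  exact Subgroup.mem_centralizer_singleton_iff.1 this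

/-! ### An orthogonal representation with central kernel. -/

open scoped Matrix.Norms.L2Operator

open Matrix MatrixOrder in
/-- A continuous real matrix representation of a compact group is conjugate to an orthogonal one. -/
theorem exists_conj_orthogonal {G : Type*} [Group G] [TopologicalSpace G] [IsTopologicalGroup G]
    [CompactSpace G] {n : ℕ} (M : G →* Matrix (Fin n) (Fin n) ℝ) (hM : Continuous M) :
    ∃ Q R : Matrix (Fin n) (Fin n) ℝ, Q * R = 1 ∧ R * Q = 1 ∧
      ∀ g, (Q * M g * R)ᵀ * (Q * M g * R) = 1 := by
  borelize G
  obtain ⟨μ, _, _, _⟩ := exists_invariant_probability (G := G)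
  -- The inverse gives `(M h)ᵀ * F g * M h = F (h⁻¹ * g)`, so left invariance of `μ` makes the
  -- averaged form `P` invariant.
  set F : G → Matrix (Fin n) (Fin n) ℝ := fun g => (M g⁻¹)ᵀ * M g⁻¹ with hF
  have hFc : Continuous F := by fun_prop
  have hFi : Integrable F μ := hFc.integrable_of_hasCompactSupport
    (HasCompactSupport.of_compactSpace _)
  set P := ∫ g, F g ∂μ with hP
  have hquad : ∀ x : Fin n → ℝ, x ⬝ᵥ (P *ᵥ x) = ∫ g, (M g⁻¹ *ᵥ x) ⬝ᵥ (M g⁻¹ *ᵥ x) ∂μ := by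
    intro x
    let l : Matrix (Fin n) (Fin n) ℝ →ₗ[ℝ] ℝ :=
      { toFun := fun A => x ⬝ᵥ (A *ᵥ x)
        map_add' := by intro A B; simp [add_mulVec]
        map_smul' := by intro c A; simp [smul_mulVec] }
    have := (LinearMap.toContinuousLinearMap l).integral_comp_comm hFi
    refine (this.symm.trans ?_)
    congr 1
    ext g
    change x ⬝ᵥ (((M g⁻¹)ᵀ * M g⁻¹) *ᵥ x) = _
    rw [← mulVec_mulVec, dotProduct_mulVec, vecMul_transpose]
  have hinv : ∀ h, (M h)ᵀ * P * M h = P := by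
    intro h
    let l : Matrix (Fin n) (Fin n) ℝ →ₗ[ℝ] Matrix (Fin n) (Fin n) ℝ :=
      LinearMap.mulLeftRight ℝ ((M h)ᵀ, M h)
    have := (LinearMap.toContinuousLinearMap l).integral_comp_comm hFi
    refine Eq.trans ?_ (this.symm.trans ?_)
    · rfl
    · rw [hP, ← integral_mul_left_eq_self F h⁻¹]
      congr 1
      ext1 g
      change (M h)ᵀ * ((M g⁻¹)ᵀ * M g⁻¹) * M h = _
      simp only [hF, _root_.mul_inv_rev, inv_inv, map_mul, transpose_mul, Matrix.mul_assoc]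
  have hsymm : P.IsHermitian := by
    let l : Matrix (Fin n) (Fin n) ℝ →ₗ[ℝ] Matrix (Fin n) (Fin n) ℝ :=
      (Matrix.transposeLinearEquiv (Fin n) (Fin n) ℝ ℝ).toLinearMap
    have := (LinearMap.toContinuousLinearMap l).integral_comp_comm hFi
    refine Eq.trans ?_ (this.symm.trans ?_)
    · rfl
    · rw [hP]
      congr 1
      ext1 g
      change ((M g⁻¹)ᵀ * M g⁻¹)ᵀ = _
      simp only [hF, transpose_mul, transpose_transpose]
  have hpos : P.PosDef := by
    refine PosDef.of_dotProduct_mulVec_pos hsymm fun x hx => ?_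
    rw [star_trivial, hquad]
    refine Continuous.integral_pos_of_hasCompactSupport_nonneg_nonzero (x := 1) ?_
      (HasCompactSupport.of_compactSpace _) ?_ ?_
    · have : Continuous fun g : G => M g⁻¹ *ᵥ x :=
        (hM.comp continuous_inv).matrix_mulVec continuous_const
      exact this.dotProduct this
    · intro g
      exact dotProduct_self_star_nonneg (M g⁻¹ *ᵥ x)
    · simpa using hx
  -- Writing `P = Qᵀ * Q`, the change of basis `Q` carries the invariant form to the standard one.
  obtain ⟨Q, hQ⟩ : ∃ Q : Matrix (Fin n) (Fin n) ℝ, P = Qᵀ * Q :=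
    CStarAlgebra.nonneg_iff_eq_star_mul_self.mp hpos.posSemidef.nonneg
  have hQu : IsUnit Q := by
    have h := hpos.isUnit
    rw [hQ, Matrix.isUnit_iff_isUnit_det, det_mul] at h
    exact (Matrix.isUnit_iff_isUnit_det _).2 (isUnit_of_mul_isUnit_right h)
  obtain ⟨Q, rfl⟩ := hQu
  refine ⟨Q, ↑Q⁻¹, Q.mul_inv, Q.inv_mul, fun g => ?_⟩
  have h := hinv g
  rw [hQ] at h
  generalize hR : (↑Q⁻¹ : Matrix (Fin n) (Fin n) ℝ) = R
  have hQR : (Q : Matrix (Fin n) (Fin n) ℝ) * R = 1 := by rw [← hR, Q.mul_inv]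
  have hRQ : Rᵀ * (Q : Matrix (Fin n) (Fin n) ℝ)ᵀ = 1 := by
    rw [← transpose_mul, hQR, transpose_one]
  calc _ = Rᵀ * ((M g)ᵀ * ((Q : Matrix (Fin n) (Fin n) ℝ)ᵀ * Q) * M g) * R := by
        simp only [transpose_mul, Matrix.mul_assoc]
    _ = 1 := by
        rw [h, ← Matrix.mul_assoc, hRQ, Matrix.one_mul, hQR]

theorem exists_orthogonal_rep_ker_le_center (E : Type*) [NormedAddCommGroup E] [NormedSpace ℝ E]
    [FiniteDimensional ℝ E] (G : Type*) [Group G] [TopologicalSpace G] [ChartedSpace E G]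
    [LieGroup 𝓘(ℝ, E) ∞ G] [CompactSpace G]
    [ConnectedSpace G] :
    ∃ (n : ℕ) (ρ : G →* Matrix (Fin n) (Fin n) ℝ), Continuous ρ ∧
      (∀ g, (ρ g).transpose * ρ g = 1) ∧ ∀ g, ρ g = 1 → g ∈ Subgroup.center G := by
  have : IsTopologicalGroup G := topologicalGroup_of_lieGroup 𝓘(ℝ, E) ∞
  let b := Module.finBasis ℝ E
  let A : (E →L[ℝ] E) →ₗ[ℝ] Matrix _ _ ℝ :=
    (LinearMap.toMatrix b b).toLinearMap ∘ₗ ContinuousLinearMap.coeLM ℝ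
  let M : G →* Matrix (Fin (Module.finrank ℝ E)) (Fin (Module.finrank ℝ E)) ℝ :=
    { toFun := fun g => A (chartAd E g)
      map_one' := by
        simp [A, chartAd_one]
      map_mul' := fun g h => by
        simp [A, chartAd_mul, LinearMap.toMatrix_comp b b b] }
  have hM : Continuous M :=
    (LinearMap.continuous_of_finiteDimensional A).comp continuous_chartAd
  obtain ⟨Q, R, hQR, hRQ, hQ⟩ := exists_conj_orthogonal M hM
  let ρ : G →* Matrix (Fin (Module.finrank ℝ E)) (Fin (Module.finrank ℝ E)) ℝ :=
    { toFun := fun g => Q * M g * R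
      map_one' := by simp [hQR]
      map_mul' := fun g h => by
        calc Q * M (g * h) * R = Q * M g * 1 * M h * R := by simp [mul_assoc]
          _ = Q * M g * R * (Q * M h * R) := by rw [← hRQ]; simp only [mul_assoc] }
  refine ⟨_, ρ, (continuous_const.mul hM).mul continuous_const, hQ, fun g hg => ?_⟩
  have h1 : M g = 1 := by
    have h2 : Q * M g * R = 1 := hg
    calc M g = R * Q * M g * (R * Q) := by rw [hRQ, one_mul, mul_one]
      _ = R * (Q * M g * R) * Q := by simp only [mul_assoc]
      _ = 1 := by rw [h2, mul_one, hRQ]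
  refine mem_center_of_chartAd_eq_id (E := E) ?_
  have h3 : LinearMap.toMatrix b b (chartAd E g : E →ₗ[ℝ] E)
      = LinearMap.toMatrix b b LinearMap.id := by
    rw [LinearMap.toMatrix_id]
    exact h1
  have h4 := (LinearMap.toMatrix b b).injective h3
  ext v
  exact LinearMap.congr_fun h4 v

/-! ### One-parameter subgroups of a normed algebra and their generators. -/

/-- A continuous one-parameter subgroup, as a predicate on functions. -/
structure IsOneParam {M : Type*} [Monoid M] [TopologicalSpace M] (α : ℝ → M) : Prop where
  continuous : Continuous α
  map_zero : α 0 = 1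
  map_add : ∀ s t, α (s + t) = α s * α t

namespace IsOneParam

variable {R : Type*} [NormedRing R] [NormedAlgebra ℝ R] {A B : ℝ → R}

theorem commute {M : Type*} [Monoid M] [TopologicalSpace M] {α : ℝ → M} (hα : IsOneParam α)
    (s t : ℝ) : Commute (α s) (α t) := by
  rw [Commute, SemiconjBy, ← hα.map_add, add_comm, hα.map_add]

theorem mul_neg {M : Type*} [Monoid M] [TopologicalSpace M] {α : ℝ → M} (hα : IsOneParam α)
    (t : ℝ) : α t * α (-t) = 1 := by
  rw [← hα.map_add, add_neg_cancel, hα.map_zero]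

theorem neg_mul {M : Type*} [Monoid M] [TopologicalSpace M] {α : ℝ → M} (hα : IsOneParam α)
    (t : ℝ) : α (-t) * α t = 1 := by
  rw [← hα.map_add, neg_add_cancel, hα.map_zero]

theorem map_neg {G : Type*} [Group G] [TopologicalSpace G] {α : ℝ → G} (hα : IsOneParam α)
    (t : ℝ) : α (-t) = (α t)⁻¹ :=
  (inv_eq_of_mul_eq_one_right (hα.mul_neg t)).symm

/-- Let `F` be the integral of `A` from `0`. Since `F a / a` tends to `1`, some `F a` is invertible,
and `A t * F a = F (t + a) - F t` exhibits `A` as differentiable. -/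
theorem exists_hasDerivAt_zero [CompleteSpace R] (hA : IsOneParam A) : ∃ X, HasDerivAt A X 0 := by
  set F : ℝ → R := fun a => ∫ s in (0 : ℝ)..a, A s with hF
  have hFd : ∀ t, HasDerivAt F (A t) t := fun t =>
    intervalIntegral.integral_hasDerivAt_right (hA.continuous.intervalIntegrable _ _)
      (hA.continuous.stronglyMeasurableAtFilter _ _) hA.continuous.continuousAt
  have hsl : ∀ᶠ a in 𝓝[≠] (0 : ℝ), IsUnit (slope F 0 a) := by
    have h := (hasDerivAt_iff_tendsto_slope.1 (hFd 0))
    rw [hA.map_zero] at h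
    exact h.eventually (Units.isOpen.mem_nhds isUnit_one)
  obtain ⟨a, ha, ha0⟩ := (hsl.and self_mem_nhdsWithin).exists
  have ha0 : a ≠ 0 := ha0
  obtain ⟨u, hu⟩ : IsUnit (F a) := by
    have h1 : F a = algebraMap ℝ R a * slope F 0 a := by
      rw [← Algebra.smul_def, slope_def_module, sub_zero, smul_inv_smul₀ ha0]
      simp [hF]
    rw [h1]
    exact ((isUnit_iff_ne_zero.2 ha0).map _).mul ha
  have hAF : ∀ t, A t = (F (t + a) - F t) * ↑u⁻¹ := by
    intro t
    rw [Units.eq_mul_inv_iff_mul_eq, hu]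
    have h1 : A t * F a = ∫ s in (0 : ℝ)..a, A (t + s) := by
      simp only [hA.map_add, hF]
      exact ((ContinuousLinearMap.mul ℝ R (A t)).intervalIntegral_comp_comm
        (hA.continuous.intervalIntegrable _ _)).symm
    rw [h1, intervalIntegral.integral_comp_add_left A t, add_zero]
    exact (intervalIntegral.integral_interval_sub_left (hA.continuous.intervalIntegrable _ _)
      (hA.continuous.intervalIntegrable _ _)).symm
  refine ⟨_, (((HasDerivAt.comp_add_const 0 a (hFd _)).sub (hFd 0)).mul_const
    (↑u⁻¹ : R)).congr_of_eventuallyEq (Eventually.of_forall hAF)⟩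

variable {X Y : R}

theorem hasDerivAt (hA : IsOneParam A) (hX : HasDerivAt A X 0) (t : ℝ) :
    HasDerivAt A (A t * X) t := by
  have h1 : HasDerivAt (fun s => A t * A (s - t)) (A t * X) t := by
    have h2 : HasDerivAt A X (t - t) := by rwa [sub_self]
    exact (h2.comp_sub_const t t).const_mul (A t)
  refine h1.congr_of_eventuallyEq (Eventually.of_forall fun s => ?_)
  change A s = A t * A (s - t)
  rw [← hA.map_add, add_sub_cancel]

theorem hasDerivAt' (hA : IsOneParam A) (hX : HasDerivAt A X 0) (t : ℝ) :
    HasDerivAt A (X * A t) t := by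
  have h1 : HasDerivAt (fun s => A (s - t) * A t) (X * A t) t := by
    have h2 : HasDerivAt A X (t - t) := by rwa [sub_self]
    exact (h2.comp_sub_const t t).mul_const (A t)
  refine h1.congr_of_eventuallyEq (Eventually.of_forall fun s => ?_)
  change A s = A (s - t) * A t
  rw [← hA.map_add, sub_add_cancel]

theorem commute_generator (hA : IsOneParam A) (hX : HasDerivAt A X 0) (t : ℝ) :
    Commute (A t) X :=
  (hA.hasDerivAt hX t).unique (hA.hasDerivAt' hX t)

theorem hasDerivAt_neg (hA : IsOneParam A) (hX : HasDerivAt A X 0) (t : ℝ) :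
    HasDerivAt (fun s => A (-s)) (-(A (-t) * X)) t := by
  simpa [Function.comp_def] using (hA.hasDerivAt hX (-t)).scomp t (_root_.hasDerivAt_neg t)

/-- The conjugate `A (-s) * C * A s` has zero derivative, hence equals its value `C` at `s = 0`. -/
theorem commute_of_commute_generator (hA : IsOneParam A) (hX : HasDerivAt A X 0) {C : R}
    (hC : Commute X C) (t : ℝ) : Commute (A t) C := by
  have hd : ∀ s, HasDerivAt (fun s => A (-s) * C * A s) 0 s := by
    intro s
    have h := ((hA.hasDerivAt_neg hX s).mul_const C).mul (hA.hasDerivAt' hX s)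
    refine h.congr_deriv ?_
    have : A (-s) * X * C = A (-s) * C * X := by rw [mul_assoc, hC.eq, mul_assoc]
    rw [_root_.neg_mul, this]
    noncomm_ring
  have hconst := is_const_of_deriv_eq_zero (fun s => (hd s).differentiableAt)
    (fun s => (hd s).deriv) t 0
  simp only [neg_zero, hA.map_zero, one_mul, mul_one] at hconst
  calc A t * C = A t * (A (-t) * C * A t) := by rw [hconst]
    _ = (A t * A (-t)) * C * A t := by simp only [mul_assoc]
    _ = C * A t := by rw [hA.mul_neg, one_mul]

theorem commute_of_commute_generators (hA : IsOneParam A) (hX : HasDerivAt A X 0)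
    (hB : IsOneParam B) (hY : HasDerivAt B Y 0) (h : Commute X Y) (s t : ℝ) :
    Commute (A s) (B t) :=
  (hB.commute_of_commute_generator hY (hA.commute_of_commute_generator hX h s).symm t).symm

end IsOneParam

/-! ### Critical points of the trace pairing on orthogonal matrices. -/

section OrthogonalOneParam

variable {n : ℕ} {A B : ℝ → Matrix (Fin n) (Fin n) ℝ} {X Y : Matrix (Fin n) (Fin n) ℝ}

theorem HasDerivAt.matrix_trace {f : ℝ → Matrix (Fin n) (Fin n) ℝ} {f' : Matrix (Fin n) (Fin n) ℝ}
    {t : ℝ} (hf : HasDerivAt f f' t) : HasDerivAt (fun s => (f s).trace) f'.trace t :=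
  (LinearMap.toContinuousLinearMap
    (Matrix.traceLinearMap (Fin n) ℝ ℝ)).hasFDerivAt.comp_hasDerivAt t hf

theorem IsOneParam.transpose_generator (hA : IsOneParam A) (hX : HasDerivAt A X 0)
    (hO : ∀ t, (A t).transpose * A t = 1) : X.transpose = -X := by
  have h1 : HasDerivAt (fun s => (A s).transpose) X.transpose 0 :=
    (LinearMap.toContinuousLinearMap
      (Matrix.transposeLinearEquiv (Fin n) (Fin n) ℝ ℝ).toLinearMap).hasFDerivAt.comp_hasDerivAt 0 hX
  have h2 := hA.hasDerivAt_neg hX 0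
  have h3 : (fun s => A (-s)) = fun s => (A s).transpose := by
    ext1 s
    calc A (-s) = (A s).transpose * A s * A (-s) := by rw [hO, one_mul]
      _ = (A s).transpose := by rw [mul_assoc, hA.mul_neg, mul_one]
  rw [h3] at h2
  simpa [hA.map_zero] using h1.unique h2

/-- If the function `h ↦ tr (X h Y h⁻¹)` on a group of orthogonal matrices attains its maximum at
`1`, then `X` and `Y` commute. -/
theorem IsOneParam.commute_generators_of_max (hA : IsOneParam A) (hX : HasDerivAt A X 0)
    (hB : IsOneParam B) (hY : HasDerivAt B Y 0)
    (hOA : ∀ t, (A t).transpose * A t = 1) (hOB : ∀ t, (B t).transpose * B t = 1)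
    (hmax : ∀ s t, (X * (A s * B t * A (-s)) * Y * (A s * B (-t) * A (-s))).trace
      ≤ (X * Y).trace) : Commute X Y := by
  have hX' := hA.transpose_generator hX hOA
  have hY' := hB.transpose_generator hY hOB
  -- Moving the factors around under the trace, `A` past its generator `X`, separates the two
  -- parameters.
  have hle : ∀ s t, (B (-t) * X * B t * (A (-s) * Y * A s)).trace ≤ (X * Y).trace := by
    intro s t
    refine le_of_eq_of_le ?_ (hmax s t)
    have h1 := (hA.commute_generator hX (-s)).eq
    calc _ = (B (-t) * (X * B t * A (-s) * Y * A s)).trace := by simp only [mul_assoc]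
      _ = (X * B t * A (-s) * Y * A s * B (-t)).trace := Matrix.trace_mul_comm _ _
      _ = ((A (-s) * A s) * (X * B t * A (-s) * Y * A s * B (-t))).trace := by
          rw [hA.neg_mul, one_mul]
      _ = (A (-s) * (A s * X * B t * A (-s) * Y * A s * B (-t))).trace := by
          simp only [mul_assoc]
      _ = (A s * X * B t * A (-s) * Y * A s * B (-t) * A (-s)).trace := Matrix.trace_mul_comm _ _
      _ = _ := by
          rw [(hA.commute_generator hX s).eq]
          simp only [mul_assoc]
  have h0 : ∀ t, (B (-t) * X * B t * Y).trace = (X * Y).trace := by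
    intro t
    calc _ = (B (-t) * (X * (B t * Y))).trace := by simp only [mul_assoc]
      _ = (X * (B t * Y) * B (-t)).trace := Matrix.trace_mul_comm _ _
      _ = (X * Y * (B t * B (-t))).trace := by
          rw [(hB.commute_generator hY t).eq]
          simp only [mul_assoc]
      _ = _ := by rw [hB.mul_neg, mul_one]
  -- By `h0` the upper bound is attained at `s = 0` for every `t`, so the `s`-derivative vanishes
  -- there for every `t`. The family `A s * B t * A (-s)` thus replaces a one-parameter subgroup
  -- with generator `[X, Y]`, which need not be available in the group.
  have hcrit : ∀ t, (B (-t) * X * B t * (Y * X - X * Y)).trace = 0 := by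
    intro t
    have hd := ((((hA.hasDerivAt_neg hX 0).mul_const Y).mul (hA.hasDerivAt hX 0)).const_mul
      (B (-t) * X * B t)).matrix_trace
    have hm : IsLocalMax (fun s => (B (-t) * X * B t * (A (-s) * Y * A s)).trace) 0 :=
      Eventually.of_forall fun s => by
        simpa [hA.map_zero, h0] using hle s t
    have := hm.hasDerivAt_eq_zero hd
    rw [← this]
    simp only [neg_zero, hA.map_zero, one_mul, mul_one]
    congr 2
    noncomm_ring
  -- The `t`-derivative at `0` of this vanishing expression is `tr ([X, Y] [Y, X])`. As `Z = [X, Y]`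
  -- is skew, this is `tr (Zᵀ Z)`, whence `Z = 0`.
  have hd := (((((hB.hasDerivAt_neg hY 0).mul_const X).mul (hB.hasDerivAt hY 0))).mul_const
      (Y * X - X * Y)).matrix_trace
  have hz : HasDerivAt (fun t => (B (-t) * X * B t * (Y * X - X * Y)).trace) 0 0 := by
    simp only [hcrit]
    exact hasDerivAt_const _ _
  have h2 := hd.unique hz
  simp only [neg_zero, hB.map_zero, one_mul, mul_one] at h2
  set Z := X * Y - Y * X with hZ
  have hZt : Z.transpose = -Z := by
    simp only [hZ, Matrix.transpose_sub, Matrix.transpose_mul, hX', hY']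
    noncomm_ring
  have h3 : (Z.conjTranspose * Z).trace = 0 := by
    rw [Matrix.conjTranspose_eq_transpose_of_trivial, hZt, ← h2]
    congr 1
    rw [hZ]
    noncomm_ring
  exact sub_eq_zero.1 (Matrix.trace_conjTranspose_mul_self_eq_zero_iff.1 h3)

end OrthogonalOneParam

/-! ### Central commutators and Hunt's argument. -/

open scoped commutatorElement

theorem commutatorElement_mul_left_of_mem_center {G : Type*} [Group G] {a b c : G}
    (h : ⁅b, c⁆ ∈ Subgroup.center G) : ⁅a * b, c⁆ = ⁅a, c⁆ * ⁅b, c⁆ := by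
  have h1 : ⁅a * b, c⁆ = a * ⁅b, c⁆ * a⁻¹ * ⁅a, c⁆ := by
    simp only [commutatorElement_def]
    group
  rw [h1, Subgroup.mem_center_iff.1 h a, mul_inv_cancel_right, Subgroup.mem_center_iff.1 h]

theorem commutatorElement_mul_right_of_mem_center {G : Type*} [Group G] {a b c : G}
    (h : ⁅a, c⁆ ∈ Subgroup.center G) : ⁅a, b * c⁆ = ⁅a, b⁆ * ⁅a, c⁆ := by
  have h1 : ⁅a, b * c⁆ = ⁅a, b⁆ * (b * ⁅a, c⁆ * b⁻¹) := by
    simp only [commutatorElement_def]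
    group
  rw [h1, Subgroup.mem_center_iff.1 h b, mul_inv_cancel_right]

namespace IsOneParam

variable {G : Type*} [Group G] [TopologicalSpace G] {α β : ℝ → G}

theorem map_nat_mul (hα : IsOneParam α) (n : ℕ) (s : ℝ) : α (n * s) = α s ^ n := by
  induction n with
  | zero => simp [hα.map_zero]
  | succ n ih => rw [Nat.cast_succ, add_mul, one_mul, hα.map_add, ih, pow_succ]

theorem map_int_of_map_one (hα : IsOneParam α) (h1 : α 1 = 1) (m : ℤ) : α m = 1 := by
  have hn : ∀ n : ℕ, α n = 1 := fun n => by simpa [h1] using hα.map_nat_mul n 1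
  obtain ⟨n, rfl | rfl⟩ := m.eq_nat_or_neg
  · exact_mod_cast hn n
  · push_cast
    rw [hα.map_neg, hn, inv_one]

theorem map {H : Type*} [Monoid H] [TopologicalSpace H] (hα : IsOneParam α) (f : G →* H)
    (hf : Continuous f) : IsOneParam fun t => f (α t) :=
  ⟨hf.comp hα.continuous, by simp [hα.map_zero], fun s t => by simp [hα.map_add]⟩

theorem conj [IsTopologicalGroup G] (hα : IsOneParam α) (g : G) :
    IsOneParam fun t => g * α t * g⁻¹ :=
  hα.map (MulAut.conj g).toMonoidHom
    ((continuous_const.mul continuous_id).mul continuous_const)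

/-- Central commutators are multiplicative in each argument. Periodicity of `α` kills them at
rational `s`, and continuity does the rest. -/
theorem commute_of_commutator_mem_center [IsTopologicalGroup G] [T2Space G]
    (hα : IsOneParam α) (hβ : IsOneParam β) (h1 : α 1 = 1)
    (hc : ∀ s t, ⁅α s, β t⁆ ∈ Subgroup.center G) (s t : ℝ) : Commute (α s) (β t) := by
  have hl : ∀ t, IsOneParam fun s => ⁅α s, β t⁆ := fun t =>
    { continuous := by
        simp only [commutatorElement_def]
        have := hα.continuous
        fun_prop
      map_zero := by simp [hα.map_zero]
      map_add := fun s s' => by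
        rw [hα.map_add]
        exact commutatorElement_mul_left_of_mem_center (hc _ _) }
  have hr : ∀ s, IsOneParam fun t => ⁅α s, β t⁆ := fun s =>
    { continuous := by
        simp only [commutatorElement_def]
        have := hβ.continuous
        fun_prop
      map_zero := by simp [hβ.map_zero]
      map_add := fun s s' => by
        rw [hβ.map_add]
        exact commutatorElement_mul_right_of_mem_center (hc _ _) }
  -- A denominator is moved from the second argument to the first by bimultiplicativity, after which
  -- `α` is evaluated at an integer.
  have hrat : (fun s => ⁅α s, β t⁆) ∘ ((↑) : ℚ → ℝ) = (fun _ => 1) ∘ ((↑) : ℚ → ℝ) := by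
    ext1 q
    have hq : (q.den : ℝ) ≠ 0 := by exact_mod_cast q.den_ne_zero
    calc ⁅α q, β t⁆ = ⁅α q, β (q.den * (t / q.den))⁆ := by rw [mul_div_cancel₀ _ hq]
      _ = ⁅α q, β (t / q.den)⁆ ^ q.den := (hr q).map_nat_mul _ _
      _ = ⁅α (q.den * q), β (t / q.den)⁆ := ((hl (t / q.den)).map_nat_mul _ _).symm
      _ = 1 := by
        have : (q.den : ℝ) * q = (q.num : ℝ) := by exact_mod_cast Rat.den_mul_eq_num q
        rw [this, hα.map_int_of_map_one h1, commutatorElement_one_left]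
  have := Rat.denseRange_cast.equalizer (hl t).continuous continuous_const hrat
  exact commutatorElement_eq_one_iff_commute.1 (congrFun this s)

end IsOneParam

/-- Hunt's argument: in a closed subgroup `K`, a one-parameter subgroup has a `K`-conjugate that
commutes with a given circle. -/
theorem exists_conj_commute_of_rep {G : Type*} [Group G] [TopologicalSpace G] [T2Space G]
    [IsTopologicalGroup G] [CompactSpace G] {n : ℕ} (ρ : G →* Matrix (Fin n) (Fin n) ℝ)
    (hρ : Continuous ρ) (hO : ∀ g, (ρ g).transpose * ρ g = 1)
    (hker : ∀ g, ρ g = 1 → g ∈ Subgroup.center G) {K : Subgroup G} (hK : IsClosed (K : Set G))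
    {α β : ℝ → G} (hα : IsOneParam α) (hβ : IsOneParam β) (hα1 : α 1 = 1)
    (hαK : ∀ t, α t ∈ K) (hβK : ∀ t, β t ∈ K) :
    ∃ k ∈ K, ∀ s t, Commute (α s) (k * β t * k⁻¹) := by
  obtain ⟨X, hX⟩ := (hα.map ρ hρ).exists_hasDerivAt_zero
  obtain ⟨Y, hY⟩ := (hβ.map ρ hρ).exists_hasDerivAt_zero
  have hf : Continuous fun k : G => (X * (ρ k * Y * ρ k⁻¹)).trace := by
    have h1 : Continuous fun k : G => ρ k⁻¹ := hρ.comp continuous_inv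
    exact (continuous_const.mul ((hρ.mul continuous_const).mul h1)).matrix_trace
  -- After replacing `β` by its conjugate by `k`, the maximum sits at the identity. The competitors
  -- used below are products of elements of `K`.
  obtain ⟨k, hk, hmax⟩ := hK.isCompact.exists_isMaxOn ⟨1, K.one_mem⟩ hf.continuousOn
  refine ⟨k, hk, ?_⟩
  have hβ' := hβ.conj k
  have hY' : HasDerivAt (fun t => ρ (k * β t * k⁻¹)) (ρ k * Y * ρ k⁻¹) 0 := by
    simp only [map_mul]
    exact (hY.const_mul (ρ k)).mul_const (ρ k⁻¹)
  -- Commuting images under `ρ` give commutators in the kernel, which is central.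
  refine hα.commute_of_commutator_mem_center hβ' hα1 fun s t => hker _ ?_
  have hXY := (hα.map ρ hρ).commute_generators_of_max hX (hβ'.map ρ hρ) hY' (fun _ => hO _)
    (fun _ => hO _) fun s t => by
      have hK' : α s * (k * β t * k⁻¹) * α (-s) * k ∈ K :=
        K.mul_mem (K.mul_mem (K.mul_mem (hαK _) (K.mul_mem (K.mul_mem hk (hβK _))
          (K.inv_mem hk))) (hαK _)) hk
      refine le_of_eq_of_le ?_ (hmax hK')
      have hinv : (α s * (k * β t * k⁻¹) * α (-s) * k)⁻¹
          = k⁻¹ * (α s * (k * β (-t) * k⁻¹) * α (-s)) := by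
        simp only [hα.map_neg, hβ.map_neg]
        group
      simp only [hinv]
      simp only [map_mul, mul_assoc]
  have hcomm := (hα.map ρ hρ).commute_of_commute_generators hX (hβ'.map ρ hρ) hY' hXY s t
  rw [commutatorElement_def]
  simp only [map_mul] at hcomm ⊢
  have e1 : ∀ g : G, ρ g * ρ g⁻¹ = 1 := fun g => by rw [← map_mul, mul_inv_cancel, map_one]
  calc _ = (ρ (α s) * (ρ k * ρ (β t) * ρ k⁻¹)) * ρ (α s)⁻¹ * ρ (k * β t * k⁻¹)⁻¹ := by
        simp only [mul_assoc]
    _ = 1 := by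
        rw [hcomm.eq, mul_assoc _ (ρ (α s)) _, e1, mul_one, ← map_mul, ← map_mul, e1]

/-! ### Tori, their circles, and maximality. -/

section Torus

variable {G : Type*} [Group G] [TopologicalSpace G]

theorem IsTorus.commute {H : Subgroup G} (hH : IsTorus H) {a b : G} (ha : a ∈ H) (hb : b ∈ H) :
    Commute a b := by
  obtain ⟨n, ⟨e⟩⟩ := hH
  have h : (⟨a, ha⟩ * ⟨b, hb⟩ : H) = ⟨b, hb⟩ * ⟨a, ha⟩ := by
    apply e.injective
    rw [map_mul, map_mul, mul_comm]
  exact congrArg Subtype.val h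

theorem IsTorus.isCompact {H : Subgroup G} (hH : IsTorus H) : IsCompact (H : Set G) := by
  obtain ⟨n, ⟨e⟩⟩ := hH
  have : CompactSpace H := e.symm.toHomeomorph.compactSpace
  exact isCompact_iff_compactSpace.2 this

theorem isTorus_range [T2Space G] {n : ℕ} (f : (Fin n → Circle) →* G) (hf : Continuous f)
    (hinj : Function.Injective f) : IsTorus f.range := by
  let e := MonoidHom.ofInjective hinj
  have he : Continuous e := hf.subtype_mk _
  let h := he.homeoOfEquivCompactToT2 (f := e.toEquiv)
  exact ⟨n, ⟨ContinuousMulEquiv.symm { e with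
    continuous_toFun := h.continuous
    continuous_invFun := h.symm.continuous }⟩⟩

/-- The one-parameter subgroup of a torus with a given velocity. -/
theorem isOneParam_torus {H : Subgroup G} {n : ℕ} (e : H ≃ₜ* (Fin n → Circle)) (v : Fin n → ℝ) :
    IsOneParam fun t : ℝ => (e.symm fun i => Circle.exp (t * v i) : G) where
  continuous := by
    refine continuous_subtype_val.comp (e.symm.continuous.comp ?_)
    fun_prop
  map_zero := by
    have : (fun i => Circle.exp (0 * v i)) = 1 := by
      ext1 i
      simp
    rw [this, map_one, OneMemClass.coe_one]
  map_add s t := by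
    have : (fun i => Circle.exp ((s + t) * v i))
        = (fun i => Circle.exp (s * v i)) * fun i => Circle.exp (t * v i) := by
      ext1 i
      rw [Pi.mul_apply, add_mul, Circle.exp_add]
    rw [this, map_mul, Subgroup.coe_mul]

theorem IsTorus.exists_oneParam_eq {H : Subgroup G} (hH : IsTorus H) {h : G} (hh : h ∈ H) {a : ℝ}
    (ha : a ≠ 0) : ∃ δ : ℝ → G, IsOneParam δ ∧ (∀ t, δ t ∈ H) ∧ δ a = h := by
  obtain ⟨n, ⟨e⟩⟩ := hH
  refine ⟨_, isOneParam_torus e fun i => (e ⟨h, hh⟩ i : ℂ).arg / a, fun t => SetLike.coe_mem _, ?_⟩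
  have : (fun i => Circle.exp (a * ((e ⟨h, hh⟩ i : ℂ).arg / a))) = e ⟨h, hh⟩ := by
    ext1 i
    rw [mul_div_cancel₀ _ ha, Circle.exp_arg]
  rw [this, ContinuousMulEquiv.symm_apply_apply]

/-- A torus is generated by finitely many circles. -/
theorem IsTorus.exists_circles {H : Subgroup G} (hH : IsTorus H) :
    ∃ (n : ℕ) (α : Fin n → ℝ → G), (∀ i, IsOneParam (α i)) ∧ (∀ i, α i 1 = 1) ∧
      (∀ i t, α i t ∈ H) ∧ ∀ L : Subgroup G, (∀ i t, α i t ∈ L) → H ≤ L := by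
  obtain ⟨n, ⟨e⟩⟩ := hH
  have hsingle : ∀ (i : Fin n) (t : ℝ), (fun j => Circle.exp (t * Pi.single (M := fun _ => ℝ) i
      (2 * Real.pi) j)) = Pi.mulSingle (M := fun _ => Circle) i (Circle.exp (t * (2 * Real.pi))) := by
    intro i t
    ext1 j
    rcases eq_or_ne j i with rfl | hj
    · simp
    · simp [hj]
  -- Velocity `2π` in the `i`-th coordinate normalizes the period of each circle to `1`.
  refine ⟨n, fun i t => (e.symm fun j => Circle.exp (t * Pi.single (M := fun _ => ℝ) i
    (2 * Real.pi) j) : G), fun i => isOneParam_torus e _, fun i => ?_,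
    fun i t => SetLike.coe_mem _, fun L hL h hh => ?_⟩
  · simp only [hsingle]
    simp
  · simp only [hsingle] at hL
    let L' : Subgroup (Fin n → Circle) := L.comap (H.subtype.comp e.symm.toMulEquiv.toMonoidHom)
    have h1 : e ⟨h, hh⟩ ∈ L' := by
      rw [← Finset.univ_prod_mulSingle (e ⟨h, hh⟩)]
      refine L'.prod_mem fun i _ => ?_
      have h2 := hL i ((e ⟨h, hh⟩ i : ℂ).arg / (2 * Real.pi))
      rw [div_mul_cancel₀ _ (by positivity), Circle.exp_arg] at h2
      exact h2
    have h3 : ((e.symm (e ⟨h, hh⟩) : H) : G) ∈ L := h1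
    rwa [ContinuousMulEquiv.symm_apply_apply] at h3

/-- The period makes `β` factor through `Circle.exp`. The argument function is a discontinuous
section, but `Circle.exp` is a quotient map, so the lift is continuous. -/
theorem IsOneParam.exists_circle_lift {β : ℝ → G} (hβ : IsOneParam β) (h1 : β (2 * Real.pi) = 1) :
    ∃ γ : Circle →* G, Continuous γ ∧ ∀ t, γ (Circle.exp t) = β t := by
  have hint : ∀ m : ℤ, β (m * (2 * Real.pi)) = 1 := fun m => by
    have h : IsOneParam fun t => β (t * (2 * Real.pi)) :=
      ⟨hβ.continuous.comp (by fun_prop), by simp [hβ.map_zero],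
        fun s t => by rw [add_mul, hβ.map_add]⟩
    exact h.map_int_of_map_one (by simpa using h1) m
  have hexp : ∀ t, β ((Circle.exp t : ℂ).arg) = β t := by
    intro t
    obtain ⟨m, hm⟩ := Circle.exp_eq_exp.1 (Circle.exp_arg (Circle.exp t))
    rw [hm, hβ.map_add, hint, mul_one]
  refine ⟨{ toFun := fun z => β (z : ℂ).arg
            map_one' := by simp [hβ.map_zero]
            map_mul' := fun z w => ?_ }, ?_, hexp⟩
  · obtain ⟨s, rfl⟩ := Circle.exp_surjective z
    obtain ⟨t, rfl⟩ := Circle.exp_surjective w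
    rw [← Circle.exp_add, hexp, hexp, hexp, hβ.map_add]
  · have hq := isLocalHomeomorph_circleExp.isOpenMap.isQuotientMap Circle.exp.continuous
      Circle.exp_surjective
    refine hq.continuous_iff.2 ?_
    exact hβ.continuous.congr fun t => (hexp t).symm

/-- A circle meeting a torus only in the identity and commuting with it spans a larger torus. -/
theorem IsTorus.exists_isTorus_of_commute [T2Space G] [IsTopologicalGroup G] {T : Subgroup G}
    (hT : IsTorus T) (γ : Circle →* G) (hγ : Continuous γ)
    (hcomm : ∀ z, ∀ t ∈ T, Commute (γ z) t) (htriv : ∀ z, γ z ∈ T → z = 1) :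
    ∃ T' : Subgroup G, IsTorus T' ∧ T ≤ T' ∧ ∀ z, γ z ∈ T' := by
  obtain ⟨n, ⟨e⟩⟩ := id hT
  let F : (Fin (n + 1) → Circle) →* G :=
    { toFun := fun z => (e.symm (Fin.tail z) : G) * γ (z 0)
      map_one' := by
        have : Fin.tail (1 : Fin (n + 1) → Circle) = 1 := rfl
        rw [this]
        simp
      map_mul' := fun z w => by
        have : Fin.tail (z * w) = Fin.tail z * Fin.tail w := rfl
        rw [this, map_mul, Subgroup.coe_mul, Pi.mul_apply, map_mul]
        have h := hcomm (z 0) (e.symm (Fin.tail w)) (SetLike.coe_mem _)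
        rw [mul_assoc, ← mul_assoc _ (γ (z 0)), ← h.eq]
        simp only [mul_assoc] }
  have hF : Continuous F := by
    have h1 : Continuous fun z : Fin (n + 1) → Circle => Fin.tail z :=
      continuous_pi fun i => continuous_apply _
    exact (continuous_subtype_val.comp (e.symm.continuous.comp h1)).mul
      (hγ.comp (continuous_apply 0))
  have hinj : Function.Injective F := by
    rw [injective_iff_map_eq_one]
    intro z hz
    have hz' : (e.symm (Fin.tail z) : G) * γ (z 0) = 1 := hz
    have h0 : z 0 = 1 := by
      refine htriv _ ?_
      rw [eq_inv_of_mul_eq_one_right hz']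
      exact T.inv_mem (SetLike.coe_mem _)
    rw [h0, map_one, mul_one] at hz'
    have h1 : Fin.tail z = 1 := by
      have h2 : e.symm (Fin.tail z) = 1 := Subtype.ext hz'
      simpa using h2
    ext1 i
    refine Fin.cases h0 (fun j => congrFun h1 j) i
  refine ⟨F.range, isTorus_range F hF hinj, fun t ht => ⟨Fin.cons 1 (e ⟨t, ht⟩), ?_⟩,
    fun z => ⟨Fin.cons z 1, ?_⟩⟩
  · simp [F]
  · simp [F]

/-- A circle commuting with a maximal torus is contained in it. -/
theorem IsMaximalTorus.mem_of_commute [T2Space G] [IsTopologicalGroup G] {T : Subgroup G}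
    (hT : IsMaximalTorus T) {β : ℝ → G} (hβ : IsOneParam β) (h1 : β 1 = 1)
    (hcomm : ∀ s, ∀ t ∈ T, Commute (β s) t) (s : ℝ) : β s ∈ T := by
  let S : AddSubgroup ℝ :=
    { carrier := {t | β t ∈ T}
      zero_mem' := by simp [hβ.map_zero]
      add_mem' := fun {a b} ha hb => by
        simp only [Set.mem_ofPred_eq] at ha hb ⊢
        rw [hβ.map_add]
        exact T.mul_mem ha hb
      neg_mem' := fun {a} ha => by
        simp only [Set.mem_ofPred_eq] at ha ⊢
        rw [hβ.map_neg]
        exact T.inv_mem ha }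
  have hSmem : ∀ t, t ∈ S ↔ β t ∈ T := fun t => Iff.rfl
  have hSc : IsClosed (S : Set ℝ) := hT.1.isCompact.isClosed.preimage hβ.continuous
  -- The times at which `β` lies in `T` form a closed subgroup of `ℝ`: either all of `ℝ`, or the
  -- multiples of some `a`, nonzero because `β 1 = 1`.
  rcases AddSubgroup.dense_or_cyclic S with hd | ⟨a, ha⟩
  · have : s ∈ (S : Set ℝ) := by
      rw [← hSc.closure_eq, hd.closure_eq]
      trivial
    exact this
  have hmem : ∀ t, β t ∈ T ↔ ∃ m : ℤ, t = m * a := fun t => by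
    rw [← hSmem, ha, AddSubgroup.mem_closure_singleton]
    simp [eq_comm]
  have ha0 : a ≠ 0 := by
    rintro rfl
    obtain ⟨m, hm⟩ := (hmem 1).1 (h1 ▸ T.one_mem)
    simp at hm
  obtain ⟨δ, hδ, hδT, hδa⟩ := hT.1.exists_oneParam_eq
    (T.inv_mem ((hmem a).2 ⟨1, by simp⟩)) ha0
  -- In the cyclic case, `β` is corrected by `δ` in `T` with `δ a = (β a)⁻¹`. The product is trivial
  -- at time `a`, rescaled to `2π`, and so gives a circle `γ` meeting `T` only in `1`. Maximality of
  -- `T` then forces `γ`, and with it `β`, into `T`.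
  have hprod : IsOneParam fun t => β (t * (a / (2 * Real.pi))) * δ (t * (a / (2 * Real.pi))) :=
    { continuous := (hβ.continuous.comp (by fun_prop)).mul (hδ.continuous.comp (by fun_prop))
      map_zero := by simp [hβ.map_zero, hδ.map_zero]
      map_add := fun s t => by
        rw [add_mul, hβ.map_add, hδ.map_add]
        have h := hcomm (t * (a / (2 * Real.pi))) _ (hδT (s * (a / (2 * Real.pi))))
        rw [mul_assoc, ← mul_assoc _ (δ _), h.eq]
        simp only [mul_assoc] }
  have h2π : 2 * Real.pi * (a / (2 * Real.pi)) = a := by field_simp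
  obtain ⟨γ, hγ, hγexp⟩ := hprod.exists_circle_lift (by
    rw [h2π, hδa, mul_inv_cancel])
  have hγT : ∀ t, γ (Circle.exp t) ∈ T ↔ β (t * (a / (2 * Real.pi))) ∈ T := fun t => by
    rw [hγexp]
    exact T.mul_mem_cancel_right (hδT _)
  obtain ⟨T', hT', hle, hγT'⟩ := hT.1.exists_isTorus_of_commute γ hγ
    (fun z t ht => by
      obtain ⟨r, rfl⟩ := Circle.exp_surjective z
      rw [hγexp]
      exact (hcomm _ t ht).mul_left (hT.1.commute (hδT _) ht))
    (fun z hz => by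
      obtain ⟨r, rfl⟩ := Circle.exp_surjective z
      obtain ⟨m, hm⟩ := (hmem _).1 ((hγT r).1 hz)
      refine Circle.exp_eq_one.2 ⟨m, ?_⟩
      field_simp at hm
      linarith)
  rw [hT.2 T' hT' hle] at hγT'
  have := (hγT (s / a * (2 * Real.pi))).1 (hγT' _)
  rwa [mul_assoc, h2π, div_mul_cancel₀ _ ha0] at this

end Torus

/-! ### Conjugating tori of `K` into `T` by elements of `K`. -/

section Conjugacy

variable (E : Type*) [NormedAddCommGroup E] [NormedSpace ℝ E] [FiniteDimensional ℝ E]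
  {G : Type*} [Group G] [TopologicalSpace G] [T2Space G] [ChartedSpace E G]
  [LieGroup 𝓘(ℝ, E) ∞ G] [CompactSpace G] [ConnectedSpace G]

theorem Subgroup.isClosed_inf_centralizer {G : Type*} [Group G] [TopologicalSpace G] [T2Space G]
    [IsTopologicalGroup G] {K : Subgroup G} (hK : IsClosed (K : Set G)) (S : Set G) :
    IsClosed ((K ⊓ Subgroup.centralizer S : Subgroup G) : Set G) :=
  hK.inter (Set.isClosed_centralizer S)

include E in
/-- In a closed subgroup `K`, a one-parameter subgroup has a `K`-conjugate that commutes with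
finitely many given commuting circles. -/
theorem exists_conj_commute_family [IsTopologicalGroup G] {ι : Type*} (F : Finset ι)
    {α : ι → ℝ → G} (hα : ∀ i, IsOneParam (α i)) (hα1 : ∀ i, α i 1 = 1)
    (hαα : ∀ i j s t, Commute (α i s) (α j t)) {K : Subgroup G} (hK : IsClosed (K : Set G))
    (hαK : ∀ i t, α i t ∈ K) {β : ℝ → G} (hβ : IsOneParam β) (hβK : ∀ t, β t ∈ K) :
    ∃ k ∈ K, ∀ i ∈ F, ∀ s t, Commute (α i s) (k * β t * k⁻¹) := by
  classical
  induction F using Finset.induction_on with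
  | empty => exact ⟨1, K.one_mem, by simp⟩
  | insert j F hj ih =>
    obtain ⟨k, hk, hcomm⟩ := ih
    obtain ⟨n, ρ, hρ, hO, hker⟩ := exists_orthogonal_rep_ker_le_center E G
    set S : Set G := {g | ∃ i ∈ F, ∃ s, α i s = g} with hS
    -- Hunt's argument is applied in the part of `K` centralizing the circles already treated, so
    -- `k'` does not disturb what has been achieved.
    obtain ⟨k', hk', hcomm'⟩ := exists_conj_commute_of_rep ρ hρ hO hker
      (Subgroup.isClosed_inf_centralizer hK S) (hα j) (hβ.conj k) (hα1 j)
      (fun t => ⟨hαK j t, by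
        rintro _ ⟨i, -, s, rfl⟩
        exact hαα i j s t⟩)
      (fun t => ⟨K.mul_mem (K.mul_mem hk (hβK t)) (K.inv_mem hk), by
        rintro _ ⟨i, hi, s, rfl⟩
        exact hcomm i hi s t⟩)
    have hconj : ∀ t, k' * k * β t * (k' * k)⁻¹ = k' * (k * β t * k⁻¹) * k'⁻¹ := fun t => by group
    refine ⟨k' * k, K.mul_mem hk'.1 hk, fun i hi s t => ?_⟩
    rw [hconj]
    rcases Finset.mem_insert.1 hi with rfl | hi
    · exact hcomm' s t
    · have h1 : Commute (α i s) k' := hk'.2 _ ⟨i, hi, s, rfl⟩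
      exact (h1.mul_right (hcomm i hi s t)).mul_right h1.inv_right

include E in
/-- In a closed subgroup `K` containing a maximal torus `T`, finitely many commuting circles can
be conjugated into `T`. -/
theorem exists_conj_mem_maximalTorus [IsTopologicalGroup G] {T K : Subgroup G}
    (hT : IsMaximalTorus T) (hK : IsClosed (K : Set G)) (hTK : T ≤ K) {ι : Type*} (F : Finset ι)
    {β : ι → ℝ → G} (hβ : ∀ i, IsOneParam (β i)) (hβ1 : ∀ i, β i 1 = 1)
    (hββ : ∀ i j s t, Commute (β i s) (β j t)) (hβK : ∀ i t, β i t ∈ K) :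
    ∃ k ∈ K, ∀ i ∈ F, ∀ t, k * β i t * k⁻¹ ∈ T := by
  classical
  obtain ⟨m, α, hα, hα1, hαT, hgen⟩ := hT.1.exists_circles
  induction F using Finset.induction_on with
  | empty => exact ⟨1, K.one_mem, by simp⟩
  | insert j F hj ih =>
    obtain ⟨k, hk, hmem⟩ := ih
    set S : Set G := {g | ∃ i ∈ F, ∃ s, k * β i s * k⁻¹ = g} with hS
    -- The circles already moved lie in the commutative group `T`, so `T` survives when `K` is cut
    -- down to their centralizer.
    have hTS : T ≤ K ⊓ Subgroup.centralizer S := fun t ht => ⟨hTK ht, by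
      rintro _ ⟨i, hi, s, rfl⟩
      exact hT.1.commute (hmem i hi s) ht⟩
    obtain ⟨k', hk', hcomm⟩ := exists_conj_commute_family E Finset.univ hα hα1
      (fun i j s t => hT.1.commute (hαT i s) (hαT j t))
      (Subgroup.isClosed_inf_centralizer hK S) (fun i t => hTS (hαT i t)) ((hβ j).conj k)
      (fun t => ⟨K.mul_mem (K.mul_mem hk (hβK j t)) (K.inv_mem hk), by
        rintro _ ⟨i, hi, s, rfl⟩
        exact (hββ i j s t).map (MulAut.conj k)⟩)
    have hconj : ∀ i t, k' * k * β i t * (k' * k)⁻¹ = k' * (k * β i t * k⁻¹) * k'⁻¹ :=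
      fun i t => by group
    refine ⟨k' * k, K.mul_mem hk'.1 hk, fun i hi t => ?_⟩
    rw [hconj]
    rcases Finset.mem_insert.1 hi with rfl | hi
    · refine hT.mem_of_commute (((hβ i).conj k).conj k') (by simp [hβ1]) (fun s t ht => ?_) t
      have hle : T ≤ Subgroup.centralizer {k' * (k * β i s * k⁻¹) * k'⁻¹} :=
        hgen _ fun l r => by
          rw [Subgroup.mem_centralizer_singleton_iff]
          exact hcomm l (Finset.mem_univ _) r s
      exact (Subgroup.mem_centralizer_singleton_iff.1 (hle ht)).symm
    · have h1 : k * β i t * k⁻¹ * k' = k' * (k * β i t * k⁻¹) := hk'.2 _ ⟨i, hi, t, rfl⟩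
      rw [← h1, mul_inv_cancel_right]
      exact hmem i hi t

include E in
/-- A torus some conjugate of which lies in a closed subgroup `K` containing a maximal torus `T`
is conjugate into `T` by elements of `K`. -/
theorem exists_conj_le_maximalTorus {T K : Subgroup G} (hT : IsMaximalTorus T)
    (hK : IsClosed (K : Set G)) (hTK : T ≤ K) {H : Subgroup G} (hH : IsTorus H) (g : G)
    (hg : ∀ h ∈ H, g⁻¹ * h * g ∈ K) : ∃ k ∈ K, ∀ h ∈ H, (g * k)⁻¹ * h * (g * k) ∈ T := by
  have : IsTopologicalGroup G := topologicalGroup_of_lieGroup 𝓘(ℝ, E) ∞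
  obtain ⟨m, η, hη, hη1, hηH, hgen⟩ := hH.exists_circles
  obtain ⟨k, hk, hkT⟩ := exists_conj_mem_maximalTorus E hT hK hTK Finset.univ
    (β := fun i t => g⁻¹ * η i t * g⁻¹⁻¹) (fun i => (hη i).conj g⁻¹) (fun i => by simp [hη1])
    (fun i j s t => (hH.commute (hηH i s) (hηH j t)).map (MulAut.conj g⁻¹))
    (fun i t => by simpa using hg _ (hηH i t))
  refine ⟨k⁻¹, K.inv_mem hk, ?_⟩
  have hle : H ≤ T.comap (MulAut.conj (g * k⁻¹)⁻¹).toMonoidHom := hgen _ fun i t => by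
    have h1 := hkT i (Finset.mem_univ _) t
    rw [Subgroup.mem_comap]
    convert h1 using 1
    change (g * k⁻¹)⁻¹ * η i t * ((g * k⁻¹)⁻¹)⁻¹ = _
    group
  intro h hh
  have h2 : (g * k⁻¹)⁻¹ * h * ((g * k⁻¹)⁻¹)⁻¹ ∈ T := hle hh
  rwa [inv_inv] at h2

end Conjugacy

/-! ### Fixed cosets, Weyl groups and the main theorem. -/

theorem mk_mem_fixedPts_iff {G : Type*} [Group G] {H K : Subgroup G} {g : G} :
    (QuotientGroup.mk g : G ⧸ K) ∈ fixedPts H (G ⧸ K) ↔ ∀ h ∈ H, g⁻¹ * h * g ∈ K := by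
  rw [MulAction.mem_fixedPoints]
  constructor
  · intro hx h hh
    have h1 : (QuotientGroup.mk (h * g) : G ⧸ K) = QuotientGroup.mk g := hx ⟨h, hh⟩
    rw [eq_comm, QuotientGroup.eq] at h1
    rwa [mul_assoc]
  · intro hx h
    change (QuotientGroup.mk ((h : G) * g) : G ⧸ K) = QuotientGroup.mk g
    rw [eq_comm, QuotientGroup.eq, ← mul_assoc]
    exact hx h h.2

/-- One inclusion suffices: `gTg⁻¹` is a torus containing `T`, so it equals `T` by maximality. -/
theorem IsMaximalTorus.mem_normalizer {G : Type*} [Group G] [TopologicalSpace G] [T2Space G]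
    [IsTopologicalGroup G] {T : Subgroup G} (hT : IsMaximalTorus T) {g : G}
    (hg : ∀ t ∈ T, g⁻¹ * t * g ∈ T) : g ∈ Subgroup.normalizer (T : Set G) := by
  obtain ⟨n, ⟨e⟩⟩ := id hT.1
  let f : (Fin n → Circle) →* G :=
    ((MulAut.conj g).toMonoidHom.comp T.subtype).comp e.symm.toMulEquiv.toMonoidHom
  have hfapp : ∀ z, f z = g * (e.symm z : G) * g⁻¹ := fun z => rfl
  have hf : Continuous f :=
    (continuous_const.mul (continuous_subtype_val.comp e.symm.continuous)).mul continuous_const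
  have hinj : Function.Injective f :=
    ((MulAut.conj g).injective.comp Subtype.val_injective).comp e.symm.injective
  have hle : T ≤ f.range := fun t ht => ⟨e ⟨g⁻¹ * t * g, hg t ht⟩, by
    rw [hfapp, ContinuousMulEquiv.symm_apply_apply]
    group⟩
  have hrange := hT.2 _ (isTorus_range f hf hinj) hle
  intro t
  constructor
  · intro ht
    rw [← hrange]
    exact ⟨e ⟨t, ht⟩, by rw [hfapp, ContinuousMulEquiv.symm_apply_apply]⟩
  · intro ht
    have h := hg _ ht
    have h' : g⁻¹ * (g * t * g⁻¹) * g = t := by group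
    rwa [h'] at h

theorem weylIncl_injective {G : Type*} [Group G] {T K : Subgroup G} (h : T ≤ K) :
    Function.Injective (weylIncl h) := by
  rw [injective_iff_map_eq_one]
  intro w
  induction w using QuotientGroup.induction_on with
  | H n =>
    intro hn
    exact (QuotientGroup.eq_one_iff _).2 ((QuotientGroup.eq_one_iff (normalizerIncl h n)).1 hn)

theorem mk_mem_range_weylIncl_iff {G : Type*} [Group G] {T K : Subgroup G} (h : T ≤ K)
    (n : Subgroup.normalizer (T : Set G)) :
    (QuotientGroup.mk n : WeylGroup T) ∈ (weylIncl h).range ↔ (n : G) ∈ K := by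
  constructor
  · rintro ⟨w, hw⟩
    induction w using QuotientGroup.induction_on with
    | H m =>
      have h1 : (QuotientGroup.mk (normalizerIncl h m) : WeylGroup T) = QuotientGroup.mk n := hw
      rw [QuotientGroup.eq] at h1
      have h2 : ((m : K) : G)⁻¹ * n ∈ T := h1
      exact (K.mul_mem_cancel_left (K.inv_mem m.1.2)).1 (h h2)
  · intro hn
    exact ⟨QuotientGroup.mk ⟨⟨n, hn⟩, fun t => n.2 t⟩, rfl⟩

theorem mainTheorem7
    {E : Type*} [NormedAddCommGroup E] [NormedSpace ℝ E] [FiniteDimensional ℝ E]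
    {G : Type*} [Group G] [TopologicalSpace G] [T2Space G] [ChartedSpace E G]
    [LieGroup 𝓘(ℝ, E) ∞ G] [CompactSpace G] [ConnectedSpace G]
    (hG : IsSemisimpleLieGroup E G)
    (T K : Subgroup G) (hT : IsMaximalTorus T) (hK : IsClosed (K : Set G)) (hTK : T ≤ K) :
    (∀ H : Subgroup G, IsTorus H → H ≤ T →
      Subgroup.quotientMapOfLE hTK '' fixedPts H (G ⧸ T) =
        fixedPts H (G ⧸ K)) ∧
    Function.Injective (weylIncl hTK) ∧
    (∃ e : (WeylGroup T ⧸ (weylIncl hTK).range) ≃ fixedPts T (G ⧸ K),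
      ∀ n : Subgroup.normalizer (T : Set G),
        (e (QuotientGroup.mk (QuotientGroup.mk n : WeylGroup T)) : G ⧸ K) =
          QuotientGroup.mk (n : G)) ∧
    MulAction.IsPretransitive (WeylGroup T) (fixedPts T (G ⧸ K)) := by
  have : IsTopologicalGroup G := topologicalGroup_of_lieGroup 𝓘(ℝ, E) ∞
  have hmk : ∀ k ∈ K, ∀ g : G, (QuotientGroup.mk (g * k) : G ⧸ K) = QuotientGroup.mk g :=
    fun k hk g => QuotientGroup.mk_mul_of_mem g hk
  let x₀ : fixedPts T (G ⧸ K) :=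
    ⟨QuotientGroup.mk 1, mk_mem_fixedPts_iff.2 fun t ht => by simpa using hTK ht⟩
  have hsmul : ∀ n : Subgroup.normalizer (T : Set G),
      (((QuotientGroup.mk n : WeylGroup T) • x₀ : fixedPts T (G ⧸ K)) : G ⧸ K) =
        QuotientGroup.mk (n : G) := fun n => by
    change (QuotientGroup.mk ((n : G) * 1) : G ⧸ K) = _
    rw [mul_one]
  -- Conjugacy with `H = T` moves the representative of a fixed coset within that coset to an
  -- element of `N(T)`.
  have hsurj : ∀ x : fixedPts T (G ⧸ K), ∃ w : WeylGroup T, w • x₀ = x := by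
    rintro ⟨x, hx⟩
    obtain ⟨g, rfl⟩ := QuotientGroup.mk_surjective x
    obtain ⟨k, hk, hkT⟩ := exists_conj_le_maximalTorus E hT hK hTK hT.1 g
      (mk_mem_fixedPts_iff.1 hx)
    refine ⟨QuotientGroup.mk ⟨g * k, hT.mem_normalizer hkT⟩, Subtype.ext ?_⟩
    rw [hsmul]
    exact hmk k hk g
  -- The class of `n` fixes the base coset exactly when `n ∈ K`, so the bijection is
  -- orbit-stabilizer.
  have hstab : (weylIncl hTK).range = MulAction.stabilizer (WeylGroup T) x₀ := by
    ext w
    induction w using QuotientGroup.induction_on with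
    | H n =>
      rw [mk_mem_range_weylIncl_iff, MulAction.mem_stabilizer_iff, Subtype.ext_iff, hsmul]
      change _ ↔ (QuotientGroup.mk (n : G) : G ⧸ K) = QuotientGroup.mk 1
      rw [eq_comm, QuotientGroup.eq, inv_one, one_mul]
  refine ⟨fun H hH _ => ?_, weylIncl_injective hTK, ?_, ⟨fun x y => ?_⟩⟩
  · refine Set.Subset.antisymm ?_ fun x hx => ?_
    · rintro _ ⟨x, hx, rfl⟩
      obtain ⟨g, rfl⟩ := QuotientGroup.mk_surjective x
      exact mk_mem_fixedPts_iff.2 fun h hh => hTK (mk_mem_fixedPts_iff.1 hx h hh)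
    · obtain ⟨g, rfl⟩ := QuotientGroup.mk_surjective x
      obtain ⟨k, hk, hkT⟩ := exists_conj_le_maximalTorus E hT hK hTK hH g
        (mk_mem_fixedPts_iff.1 hx)
      exact ⟨QuotientGroup.mk (g * k), mk_mem_fixedPts_iff.2 hkT, hmk k hk g⟩
  · rw [hstab]
    refine ⟨Equiv.ofBijective (MulAction.ofQuotientStabilizer (WeylGroup T) x₀)
      ⟨MulAction.injective_ofQuotientStabilizer _ _, fun x => ?_⟩, hsmul⟩
    obtain ⟨w, hw⟩ := hsurj x
    exact ⟨QuotientGroup.mk w, hw⟩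
  · obtain ⟨w, rfl⟩ := hsurj x
    obtain ⟨v, rfl⟩ := hsurj y
    exact ⟨v * w⁻¹, by rw [smul_smul, inv_mul_cancel_right]⟩
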